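/- Let $d\ge 2$ be an integer and let $\Sigma_\pm=\{-d+1,\dots,d-1\}$. For a word $\sigma=k_0k_1\cdots k_n$ over $\Sigma_\pm$ put $[\sigma]=\sum_{i=0}^n k_i d^i$ (and $[\epsilon]=0$ for the empty word). The canonical representation of a positive integer is its usual base-$d$ expansion with the least significant digit first; that of $0$ is the empty word; that of a negative integer $a$ is obtained from that of $-a$ by negating every digit. A set $A\subseteq\mathbb{Z}$ is - *$d$-automatic* if $\{\sigma\in\Sigma_\pm^* : [\sigma]\in A\}$ is a regular language over $\Sigma_\pm$; - *$d$-sparse* if the set $L$ of canonical representations of elements of $A$ is a regular language over $\Sigma_\pm$ and $|\{\sigma\in L : |\sigma|\le k\}|$ is bounded above by a polynomial in $k$; - *stable in $(\mathbb{Z},+)$* if there is $N\in\mathbb{N}$ for which there are no $a_0,\dots,a_N,b_0,\dots,b_N\in\mathbb{Z}$ such that, for all $i,j\in\{0,\dots,N\}$, $a_i+b_j\in A$ if and only if $i\le j$; - *generic* if finitely many additive translates of $A$ cover $\mathbb{Z}$. Theorem. (1) If $A\subseteq\mathbb{Z}$ is $d$-automatic, not $d$-sparse, and stable in $(\mathbb{Z},+)$,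 then $A$ is generic. (2) Consequently, every $A\subseteq\mathbb{N}$ that, as a subset of $\mathbb{Z}$, is $d$-automatic and stable in $(\mathbb{Z},+)$ is $d$-sparse. -/

import Mathlib

namespace AutomaticSets

/-! ### Stable relations and stable subsets of groups -/

/-- `a 0, …, a N, b 0, …, b N` form an `N`-ladder for the binary relation `R`:
`R (a i) (b j)` holds if and only if `i ≤ j`. -/
def IsLadder {X : Type*} (R : X → X → Prop) (N : ℕ) (a b : Fin (N + 1) → X) : Prop :=
  ∀ i j, R (a i) (b j) ↔ i ≤ j

/-- `R` is `N`-stable if there is no `N`-ladder for `R`. -/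
def IsNStable {X : Type*} (R : X → X → Prop) (N : ℕ) : Prop :=
  ¬ ∃ a b : Fin (N + 1) → X, IsLadder R N a b

/-- `R` is stable if it is `N`-stable for some `N`. -/
def IsStableRel {X : Type*} (R : X → X → Prop) : Prop :=
  ∃ N : ℕ, IsNStable R N

/-- A subset `A` of a group `(G, +)` is stable in `G` if `x + y ∈ A` is a stable relation on `G`. -/
def IsStableIn {G : Type*} [AddGroup G] (A : Set G) : Prop :=
  IsStableRel fun x y : G => x + y ∈ A

/-! ### Words and their values in base `d` -/

/-- The alphabet `{-d + 1, …, d - 1}`. -/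
abbrev SignedDigit (d : ℕ) : Type :=
  {k : ℤ // k ∈ Finset.Icc (-(d : ℤ) + 1) ((d : ℤ) - 1)}

/-- The value `k₀ + k₁ d + ⋯ + kₙ dⁿ` of a word `k₀ k₁ ⋯ kₙ` of integers
(least significant digit first). -/
def wordValue (d : ℕ) : List ℤ → ℤ
  | [] => 0
  | k :: w => k + d * wordValue d w

theorem wordValue_eq_sum (d : ℕ) (w : List ℤ) :
    wordValue d w = ∑ i : Fin w.length, w.get i * (d : ℤ) ^ (i : ℕ) := by
  induction w with
  | nil => simp [wordValue]
  | cons k w ih =>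
    rw [wordValue, ih]
    simp only [List.length_cons, Fin.sum_univ_succ, Finset.mul_sum]
    have h : ∀ i : Fin w.length,
        (k :: w).get i.succ * (d : ℤ) ^ (i.succ : ℕ) = d * (w.get i * (d : ℤ) ^ (i : ℕ)) := by
      intro i
      simp only [List.get_cons_succ', Fin.val_succ, pow_succ]
      ring
    simp only [h]
    simp

/-- The word of integers underlying a word over the alphabet `{-d + 1, …, d - 1}`. -/
def toIntWord {d : ℕ} (σ : List (SignedDigit d)) : List ℤ :=
  σ.map Subtype.val

/-- The language of all words over `{-d + 1, …, d - 1}` whose base-`d` value lies in `A`. -/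
def representations (d : ℕ) (A : Set ℤ) : Language (SignedDigit d) :=
  {σ | wordValue d (toIntWord σ) ∈ A}

/-- `A ⊆ ℤ` is `d`-automatic if the language of all words over `{-d + 1, …, d - 1}` representing
an element of `A` is regular. -/
def IsAutomatic (d : ℕ) (A : Set ℤ) : Prop :=
  (representations d A).IsRegular

/-! ### Canonical representations and sparsity -/

/-- The canonical base-`d` representation of an integer `a` (for `d ≥ 2`): the usual base-`d`
expansion of `|a|`, least significant digit first, with all digits negated if `a < 0`.
The canonical representation of `0` is the empty word. -/
def canonicalWord (d : ℕ) (a : ℤ) : List ℤ :=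
  (Nat.digits d a.natAbs).map fun k : ℕ => a.sign * (k : ℤ)

/-- The language of canonical representations of the elements of `A`, over the alphabet
`{-d + 1, …, d - 1}`. -/
def canonicalRepresentations (d : ℕ) (A : Set ℤ) : Language (SignedDigit d) :=
  {σ | ∃ a ∈ A, toIntWord σ = canonicalWord d a}

/-- For `d ≥ 2` every canonical representation is a word over `{-d + 1, …, d - 1}`. -/
theorem exists_toIntWord_eq_canonicalWord {d : ℕ} (hd : 2 ≤ d) (a : ℤ) :
    ∃ σ : List (SignedDigit d), toIntWord σ = canonicalWord d a := by
  have h : ∀ k ∈ canonicalWord d a, k ∈ Finset.Icc (-(d : ℤ) + 1) ((d : ℤ) - 1) := by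
    intro k hk
    obtain ⟨m, hm, rfl⟩ := List.mem_map.1 hk
    have hlt : m < d := Nat.digits_lt_base (by omega) hm
    rw [Finset.mem_Icc]
    rcases lt_trichotomy a 0 with ha | ha | ha
    · rw [Int.sign_eq_neg_one_of_neg ha]; omega
    · subst ha; simp; omega
    · rw [Int.sign_eq_one_of_pos ha]; omega
  refine ⟨(canonicalWord d a).pmap Subtype.mk h, ?_⟩
  simp [toIntWord, List.map_pmap]

/-- The canonical representation of `a` represents `a`. -/
theorem wordValue_canonicalWord (d : ℕ) (a : ℤ) : wordValue d (canonicalWord d a) = a := by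
  have h : ∀ (s : ℤ) (l : List ℕ),
      wordValue d (l.map fun k : ℕ => s * (k : ℤ)) = s * (Nat.ofDigits d l : ℕ) := by
    intro s l
    induction l with
    | nil => simp [wordValue]
    | cons k l ih =>
      rw [List.map_cons, wordValue, ih, Nat.ofDigits_cons]
      push_cast
      ring
  rw [canonicalWord, h, Nat.ofDigits_digits, Int.sign_mul_natAbs]

/-- A language over a finite alphabet is sparse if it is regular and the number of its words of
length at most `k` is bounded by a polynomial in `k`. -/
def IsSparseLanguage {α : Type*} [Finite α] (L : Language α) : Prop :=
  L.IsRegular ∧ ∃ C m : ℕ, ∀ k : ℕ, {σ : List α | σ ∈ L ∧ σ.length ≤ k}.ncard ≤ C * (k + 1) ^ m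

/-- `A ⊆ ℤ` is `d`-sparse if the language of canonical base-`d` representations of its elements
is sparse. -/
def IsSparse (d : ℕ) (A : Set ℤ) : Prop :=
  IsSparseLanguage (canonicalRepresentations d A)

/-! ### Generic sets -/

/-- `A ⊆ ℤ` is generic if finitely many additive translates of `A` cover `ℤ`. -/
def IsGeneric (A : Set ℤ) : Prop :=
  ∃ T : Finset ℤ, (⋃ t ∈ T, (fun a : ℤ => t + a) '' A) = Set.univ

end AutomaticSets

namespace AutomaticSets

/-! ### Stable sets invariant under two expanding affine maps -/

/-! Let `M` be an automaton for all signed representations of elements of `A`. If no state has two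
distinct loops of equal length occurring in canonical words, such words are determined by
polynomially many data (`eq_of_lastVisit_eq`). So a non-sparse `A` yields a prefix `u` and loops `v₁
≠ v₂`, and the set `B` of all `x` with `[u] + d ^ |u| * x ∈ A` is invariant, in both directions,
under `x ↦ [vᵢ] + D * x` with `D = d ^ |v₁|`. Stability passes to `B`, and the two maps would build
a ladder unless each `t ∈ B` has another element of `B` within a bounded distance on either side
(`exists_add_mul_pow_mem`). Hence `B` has bounded gaps, and so does `A`. A set of naturals is
bounded below, hence never generic, which gives (2). -/

theorem exists_mem_near_of_bounded_gaps {B : Set ℤ} {K : ℤ} {t₀ : ℤ} (ht₀ : t₀ ∈ B)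
    (hup : ∀ t ∈ B, ∃ t' ∈ B, t < t' ∧ t' ≤ t + K)
    (hdown : ∀ t ∈ B, ∃ t' ∈ B, t' < t ∧ t - K ≤ t') (z : ℤ) :
    ∃ b ∈ B, |z - b| ≤ K := by
  have hK : 0 ≤ K := by
    obtain ⟨t', -, h₁, h₂⟩ := hup t₀ ht₀
    omega
  rcases le_total t₀ z with hz | hz
  · suffices h : ∃ b ∈ B, b ≤ z ∧ z - b ≤ K by
      obtain ⟨b, hb, h₁, h₂⟩ := h
      exact ⟨b, hb, by rw [abs_le]; omega⟩
    induction z, hz using Int.leInduction with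
    | base => exact ⟨t₀, ht₀, le_rfl, by omega⟩
    | succ z _ ih =>
      obtain ⟨b, hb, h₁, h₂⟩ := ih
      by_cases h : z + 1 - b ≤ K
      · exact ⟨b, hb, by omega, h⟩
      · obtain ⟨t', ht', h₃, h₄⟩ := hup b hb
        exact ⟨t', ht', by omega, by omega⟩
  · suffices h : ∃ b ∈ B, z ≤ b ∧ b - z ≤ K by
      obtain ⟨b, hb, h₁, h₂⟩ := h
      exact ⟨b, hb, by rw [abs_le]; omega⟩
    induction z, hz using Int.leInductionDown with
    | base => exact ⟨t₀, ht₀, le_rfl, by omega⟩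
    | pred z _ ih =>
      obtain ⟨b, hb, h₁, h₂⟩ := ih
      by_cases h : b - (z - 1) ≤ K
      · exact ⟨b, hb, by omega, h⟩
      · obtain ⟨t', ht', h₃, h₄⟩ := hdown b hb
        exact ⟨t', ht', by omega, by omega⟩

theorem isGeneric_of_exists_mem_near {A : Set ℤ} {K : ℤ} (h : ∀ z, ∃ a ∈ A, |z - a| ≤ K) :
    IsGeneric A := by
  refine ⟨Finset.Icc (-K) K, Set.eq_univ_of_forall fun z => ?_⟩
  obtain ⟨a, ha, hza⟩ := h z
  simp only [Set.mem_iUnion]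
  exact ⟨z - a, by rw [Finset.mem_Icc]; exact abs_le.1 hza, a, ha, by ring⟩

theorem IsStableIn.preimage_affine {A : Set ℤ} (h : IsStableIn A) (r c : ℤ) :
    IsStableIn {x : ℤ | r + c * x ∈ A} := by
  obtain ⟨N, hN⟩ := h
  refine ⟨N, fun ⟨a, b, hab⟩ => hN ⟨fun i => r + c * a i, fun j => c * b j, fun i j => ?_⟩⟩
  rw [← hab i j]
  change r + c * a i + c * b j ∈ A ↔ r + c * (a i + b j) ∈ A
  rw [mul_add, add_assoc]

theorem iterate_affine_add (D b y s : ℤ) (i : ℕ) :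
    (fun x => b + D * x)^[i] (y + s) = (fun x => b + D * x)^[i] y + s * D ^ i := by
  induction i generalizing y s with
  | zero => simp
  | succ i ih =>
    rw [Function.iterate_succ_apply, Function.iterate_succ_apply,
      show b + D * (y + s) = (b + D * y) + D * s by ring, ih, pow_succ]
    ring

/-- With `s = b₂ - b₁`, the second map is the first followed by translation by `s`. If every `t + s
* D ^ m` with `m < N` missed `B`, the points `s * D ^ i` and the iterates of `t` would form a
ladder. Exchanging the two maps replaces `s` by `-s`, which gives the other direction. -/
theorem exists_add_mul_pow_mem {B : Set ℤ} {N : ℕ} (hN : IsNStable (fun x y : ℤ => x + y ∈ B) N)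
    {D b₁ b₂ : ℤ} (h₁ : ∀ x, b₁ + D * x ∈ B ↔ x ∈ B) (h₂ : ∀ x, b₂ + D * x ∈ B ↔ x ∈ B)
    {t : ℤ} (ht : t ∈ B) : ∃ m < N, t + (b₂ - b₁) * D ^ m ∈ B := by
  by_contra! hcon
  set f : ℤ → ℤ := fun x => b₁ + D * x with hf
  have hiter : ∀ n x, f^[n] x ∈ B ↔ x ∈ B := by
    intro n
    induction n with
    | zero => simp
    | succ n ih =>
      intro x
      rw [Function.iterate_succ_apply, ih, hf, h₁]
  refine hN ⟨fun i => (b₂ - b₁) * D ^ (i : ℕ), fun j => f^[(j : ℕ) + 1] t, fun i j => ?_⟩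
  change (b₂ - b₁) * D ^ (i : ℕ) + f^[(j : ℕ) + 1] t ∈ B ↔ i ≤ j
  rw [add_comm, Fin.le_def]
  by_cases hij : (i : ℕ) ≤ j
  · obtain ⟨k, hk⟩ := Nat.exists_eq_add_of_le hij
    refine iff_of_true ?_ hij
    -- For `i ≤ j` the sum is `f^[i]` of `f (f^[k] t) + (b₂ - b₁)`, the second map applied to `f^[k]
    -- t`.
    rw [hk, add_assoc, Function.iterate_add_apply, hf, ← iterate_affine_add, ← hf, hiter,
      Function.iterate_succ_apply']
    have : f (f^[k] t) + (b₂ - b₁) = b₂ + D * f^[k] t := by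
      rw [hf]
      ring
    rw [this, h₂, hiter]
    exact ht
  · obtain ⟨k, hk⟩ := Nat.exists_eq_add_of_le (show (j : ℕ) + 1 ≤ i by omega)
    refine iff_of_false ?_ hij
    -- For `i > j` the sum is `f^[j + 1]` of `t + (b₂ - b₁) * D ^ k` with `k = i - j - 1 < N`.
    rw [hk, pow_add, mul_comm (D ^ _), ← mul_assoc, hf, ← iterate_affine_add, ← hf, hiter]
    exact hcon k (by omega)

theorem exists_mem_near_of_stable {B : Set ℤ} (hB : IsStableIn B) {D b₁ b₂ : ℤ} (hD : 1 ≤ D)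
    (h₁ : ∀ x, b₁ + D * x ∈ B ↔ x ∈ B) (h₂ : ∀ x, b₂ + D * x ∈ B ↔ x ∈ B) (hne : b₁ ≠ b₂)
    (hB₀ : B.Nonempty) : ∃ K, ∀ z, ∃ b ∈ B, |z - b| ≤ K := by
  wlog hlt : b₁ < b₂ generalizing b₁ b₂
  · exact this h₂ h₁ hne.symm (by omega)
  obtain ⟨N, hN⟩ := hB
  obtain ⟨t₀, ht₀⟩ := hB₀
  have hpos : ∀ m, 0 < (b₂ - b₁) * D ^ m := fun m => mul_pos (by omega) (pow_pos (by omega) m)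
  have hle : ∀ m < N, (b₂ - b₁) * D ^ m ≤ (b₂ - b₁) * D ^ N := fun m hm =>
    mul_le_mul_of_nonneg_left (pow_le_pow_right₀ hD hm.le) (by omega)
  refine ⟨(b₂ - b₁) * D ^ N, exists_mem_near_of_bounded_gaps ht₀ (fun t ht => ?_) fun t ht => ?_⟩
  · obtain ⟨m, hm, hmem⟩ := exists_add_mul_pow_mem hN h₁ h₂ ht
    exact ⟨_, hmem, by linarith [hpos m], by linarith [hle m hm]⟩
  · obtain ⟨m, hm, hmem⟩ := exists_add_mul_pow_mem hN h₂ h₁ ht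
    rw [← neg_sub b₂ b₁, neg_mul] at hmem
    exact ⟨_, hmem, by linarith [hpos m], by linarith [hle m hm]⟩

theorem isGeneric_of_preimage {A : Set ℤ} {r c : ℤ} (hc : 0 < c) {K : ℤ}
    (h : ∀ z, ∃ b ∈ {x : ℤ | r + c * x ∈ A}, |z - b| ≤ K) : IsGeneric A := by
  refine isGeneric_of_exists_mem_near (K := c + |r| + c * K) fun z => ?_
  obtain ⟨b, hb, hzb⟩ := h (z / c)
  refine ⟨_, hb, ?_⟩
  have hz : z - (r + c * b) = z % c + -r + c * (z / c - b) := by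
    linarith [Int.emod_add_mul_ediv z c]
  rw [hz]
  refine (abs_add_three _ _ _).trans ?_
  rw [abs_neg, abs_mul, abs_of_pos hc, abs_of_nonneg (Int.emod_nonneg z hc.ne')]
  have := mul_le_mul_of_nonneg_left hzb hc.le
  linarith [Int.emod_lt_of_pos z hc]

theorem not_isGeneric_of_subset_range_natCast {A : Set ℤ}
    (hA : A ⊆ Set.range ((↑) : ℕ → ℤ)) : ¬ IsGeneric A := by
  rintro ⟨T, hT⟩
  obtain ⟨m, hm⟩ := T.bddBelow
  have hmem : m - 1 ∈ ⋃ t ∈ T, (fun a : ℤ => t + a) '' A := hT ▸ Set.mem_univ _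
  simp only [Set.mem_iUnion] at hmem
  obtain ⟨t, ht, a, ha, hta⟩ := hmem
  obtain ⟨n, rfl⟩ := hA ha
  have := hm (Finset.mem_coe.2 ht)
  simp only at hta
  omega

/-! ### Words and digits -/

theorem wordValue_append (d : ℕ) (u v : List ℤ) :
    wordValue d (u ++ v) = wordValue d u + (d : ℤ) ^ u.length * wordValue d v := by
  induction u with
  | nil => simp [wordValue]
  | cons k u ih =>
    rw [List.cons_append, wordValue, wordValue, ih, List.length_cons, pow_succ]
    ring

theorem toIntWord_append {d : ℕ} (u v : List (SignedDigit d)) :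
    toIntWord (u ++ v) = toIntWord u ++ toIntWord v :=
  List.map_append

theorem length_toIntWord {d : ℕ} (u : List (SignedDigit d)) : (toIntWord u).length = u.length :=
  List.length_map _

theorem toIntWord_injective {d : ℕ} : Function.Injective (toIntWord (d := d)) :=
  List.map_injective_iff.2 Subtype.val_injective

theorem bounds_of_mem_toIntWord {d : ℕ} {σ : List (SignedDigit d)} {k : ℤ}
    (hk : k ∈ toIntWord σ) : -(d : ℤ) < k ∧ k < d := by
  obtain ⟨⟨k, hk'⟩, -, rfl⟩ := List.mem_map.1 hk
  rw [Finset.mem_Icc] at hk'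
  simp only
  omega

theorem wordValue_map_neg (d : ℕ) (w : List ℤ) :
    wordValue d (w.map Neg.neg) = -wordValue d w := by
  induction w with
  | nil => rfl
  | cons k w ih =>
    rw [List.map_cons, wordValue, wordValue, ih]
    ring

theorem wordValue_nonneg {d : ℕ} {w : List ℤ} (h : ∀ k ∈ w, 0 ≤ k) : 0 ≤ wordValue d w := by
  induction w with
  | nil => exact le_rfl
  | cons k w ih =>
    rw [List.forall_mem_cons] at h
    exact add_nonneg h.1 (mul_nonneg (by positivity) (ih h.2))

theorem eq_of_wordValue_eq_of_nonneg {d : ℕ} {v w : List ℤ}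
    (hv : ∀ k ∈ v, 0 ≤ k ∧ k < d) (hw : ∀ k ∈ w, 0 ≤ k ∧ k < d)
    (hlen : v.length = w.length) (h : wordValue d v = wordValue d w) : v = w := by
  induction v generalizing w with
  | nil => exact (List.length_eq_zero_iff.1 hlen.symm).symm
  | cons k v ih =>
    cases w with
    | nil => simp at hlen
    | cons l w =>
      rw [List.forall_mem_cons] at hv hw
      simp only [wordValue] at h
      have hkl : k = l := by
        have := congrArg (· % (d : ℤ)) h
        simpa [Int.emod_eq_of_lt hv.1.1 hv.1.2, Int.emod_eq_of_lt hw.1.1 hw.1.2] using this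
      subst hkl
      have hd : (d : ℤ) ≠ 0 := by omega
      rw [ih hv.2 hw.2 (by simpa using hlen) (mul_left_cancel₀ hd (add_left_cancel h))]

/-- All digits are nonnegative, or all digits are nonpositive. -/
def HasConstantSign (w : List ℤ) : Prop :=
  (∀ k ∈ w, 0 ≤ k) ∨ ∀ k ∈ w, k ≤ 0

theorem HasConstantSign.of_sublist {v w : List ℤ} (hw : HasConstantSign w) (h : v.Sublist w) :
    HasConstantSign v :=
  hw.imp (fun H k hk => H k (h.subset hk)) fun H k hk => H k (h.subset hk)

theorem HasConstantSign.neg {w : List ℤ} (hw : HasConstantSign w) :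
    HasConstantSign (w.map Neg.neg) := by
  rcases hw with h | h
  · exact Or.inr (List.forall_mem_map.2 fun k hk => neg_nonpos.2 (h k hk))
  · exact Or.inl (List.forall_mem_map.2 fun k hk => neg_nonneg.2 (h k hk))

/-- Constant sign is essential: in base 2 the words `1 0` and `-1 1` both have value 1. -/
theorem eq_of_wordValue_eq {d : ℕ} {v w : List ℤ} (hv : HasConstantSign v)
    (hw : HasConstantSign w) (hv' : ∀ k ∈ v, -(d : ℤ) < k ∧ k < d)
    (hw' : ∀ k ∈ w, -(d : ℤ) < k ∧ k < d)
    (hlen : v.length = w.length) (h : wordValue d v = wordValue d w) : v = w := by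
  wlog hpos : ∀ k ∈ v, 0 ≤ k generalizing v w
  · have hneg : ∀ k ∈ v, k ≤ 0 := hv.resolve_left hpos
    have := this (v := v.map Neg.neg) (w := w.map Neg.neg) hv.neg hw.neg
      (List.forall_mem_map.2 fun k hk => by have := hv' k hk; omega)
      (List.forall_mem_map.2 fun k hk => by have := hw' k hk; omega)
      (by simpa using hlen) (by rw [wordValue_map_neg, wordValue_map_neg, h])
      (List.forall_mem_map.2 fun k hk => neg_nonneg.2 (hneg k hk))
    exact List.map_injective_iff.2 neg_injective this
  rcases hw with hw | hw
  · exact eq_of_wordValue_eq_of_nonneg (fun k hk => ⟨hpos k hk, (hv' k hk).2⟩)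
      (fun k hk => ⟨hw k hk, (hw' k hk).2⟩) hlen h
  -- With opposite signs the common value is 0, so both words consist of zeros.
  · have hw₀ : 0 ≤ wordValue d (w.map Neg.neg) :=
      wordValue_nonneg (List.forall_mem_map.2 fun k hk => neg_nonneg.2 (hw k hk))
    have hv₀ := wordValue_nonneg (d := d) hpos
    rw [wordValue_map_neg] at hw₀
    have hzero : wordValue d (List.replicate v.length 0) = 0 := by
      induction v.length with
      | zero => rfl
      | succ n ih => rw [List.replicate_succ, wordValue, ih]; simp
    have hrep : ∀ k ∈ List.replicate v.length (0 : ℤ), 0 ≤ k ∧ k < (d : ℤ) ∨ v = [] := by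
      intro k hk
      obtain ⟨hlen₀, rfl⟩ := List.mem_replicate.1 hk
      cases v with
      | nil => simp at hlen₀
      | cons l v =>
        have h₁ := hv' l (by simp)
        have h₂ := hpos l (by simp)
        exact Or.inl ⟨le_rfl, by omega⟩
    rcases eq_or_ne v [] with rfl | hne
    · exact (List.length_eq_zero_iff.1 hlen.symm).symm
    have hrep' := fun k hk => (hrep k hk).resolve_right hne
    have e₁ : v = List.replicate v.length 0 :=
      eq_of_wordValue_eq_of_nonneg (fun k hk => ⟨hpos k hk, (hv' k hk).2⟩) hrep' (by simp)
        (by rw [hzero]; omega)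
    have e₂ : w.map Neg.neg = List.replicate v.length 0 := by
      refine eq_of_wordValue_eq_of_nonneg (fun k hk => ?_) hrep' (by simp [hlen])
        (by rw [hzero, wordValue_map_neg]; omega)
      obtain ⟨l, hl, rfl⟩ := List.mem_map.1 hk
      have := hw l hl
      have := hw' l hl
      omega
    refine List.map_injective_iff.2 neg_injective (e₂ ▸ ?_)
    conv_lhs => rw [e₁]
    simp

/-! ### Canonical words form a regular language -/

/-- The digits have constant sign and the most significant digit is nonzero. -/
def IsCanonical (w : List ℤ) : Prop :=
  HasConstantSign w ∧ ∀ h : w ≠ [], w.getLast h ≠ 0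

theorem isCanonical_canonicalWord (d : ℕ) (a : ℤ) : IsCanonical (canonicalWord d a) := by
  refine ⟨?_, fun h => ?_⟩
  · rcases le_total 0 a with ha | ha
    · left
      intro k hk
      obtain ⟨m, -, rfl⟩ := List.mem_map.1 hk
      exact mul_nonneg (Int.sign_nonneg_iff.2 ha) (by positivity)
    · right
      intro k hk
      obtain ⟨m, -, rfl⟩ := List.mem_map.1 hk
      exact mul_nonpos_of_nonpos_of_nonneg (Int.sign_nonpos_iff.2 ha) (by positivity)
  · have ha : a ≠ 0 := by
      rintro rfl
      simp [canonicalWord] at h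
    simp only [canonicalWord, List.getLast_map]
    exact mul_ne_zero (mt Int.sign_eq_zero_iff_zero.1 ha)
      (Nat.cast_ne_zero.2 (Nat.getLast_digit_ne_zero d (by simpa using ha)))

theorem IsCanonical.eq_canonicalWord {d : ℕ} (hd : 2 ≤ d) {w : List ℤ} (hw : IsCanonical w)
    (hw' : ∀ k ∈ w, -(d : ℤ) < k ∧ k < d) : w = canonicalWord d (wordValue d w) := by
  have key : ∀ (s : ℤ) (_ : s = 1 ∨ s = -1) (_ : ∀ k ∈ w, 0 ≤ s * k),
      w = canonicalWord d (wordValue d w) := by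
    intro s hs hpos
    have hss : s * s = 1 := by rcases hs with rfl | rfl <;> rfl
    set L : List ℕ := w.map fun k => (s * k).toNat with hL
    have hwL : w = L.map fun k : ℕ => s * (k : ℤ) := by
      rw [hL, List.map_map]
      refine ((List.map_congr_left fun k hk => ?_).trans (List.map_id w)).symm
      simp only [Function.comp, Int.toNat_of_nonneg (hpos k hk), ← mul_assoc, hss, one_mul, id]
    have hlt : ∀ l ∈ L, l < d := by
      intro l hl
      obtain ⟨k, hk, rfl⟩ := List.mem_map.1 hl
      have := hw' k hk
      rcases hs with rfl | rfl <;> omega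
    have hlast : ∀ h : L ≠ [], L.getLast h ≠ 0 := by
      intro h h₀
      refine hw.2 (by simpa [hL] using h) ?_
      simp only [hwL, List.getLast_map, h₀]
      simp
    have hdig := Nat.digits_ofDigits d (by omega) L hlt hlast
    have hval : wordValue d w = s * (Nat.ofDigits d L : ℕ) := by
      rw [hwL]
      generalize L = L
      induction L with
      | nil => simp [wordValue]
      | cons k l ih =>
        rw [List.map_cons, wordValue, ih, Nat.ofDigits_cons]
        push_cast
        ring
    have habs : (s * (Nat.ofDigits d L : ℕ) : ℤ).natAbs = Nat.ofDigits d L := by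
      rcases hs with rfl | rfl <;> simp
    rw [canonicalWord, hval, habs, hdig]
    -- At value 0 the sign is 0 rather than `s`, but then the word is empty.
    rcases Nat.eq_zero_or_pos (Nat.ofDigits d L) with h₀ | h₀
    · have : L = [] := by rw [← hdig, h₀, Nat.digits_zero]
      rw [hwL, this]
      rfl
    · have hsign : (s * (Nat.ofDigits d L : ℕ) : ℤ).sign = s := by
        rw [Int.sign_mul, Int.sign_natCast_of_ne_zero h₀.ne', mul_one]
        rcases hs with rfl | rfl <;> rfl
      rw [hsign]
      exact hwL
  rcases hw.1 with h | h
  · exact key 1 (Or.inl rfl) (by simpa using h)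
  · exact key (-1) (Or.inr rfl) (by simpa using h)

/-- The automaton recognizing canonical words: it records whether all digits so far are
nonnegative, whether all are nonpositive, and whether the last one is nonzero. -/
def canonicalDFA (d : ℕ) : DFA (SignedDigit d) (Prop × Prop × Prop) where
  step s k := (s.1 ∧ 0 ≤ k.1, s.2.1 ∧ k.1 ≤ 0, k.1 ≠ 0)
  start := (True, True, True)
  accept := {s | (s.1 ∨ s.2.1) ∧ s.2.2}

theorem eval_canonicalDFA (d : ℕ) (σ : List (SignedDigit d)) :
    (canonicalDFA d).eval σ = (∀ k ∈ toIntWord σ, 0 ≤ k, ∀ k ∈ toIntWord σ, k ≤ 0,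
      ∀ h : toIntWord σ ≠ [], (toIntWord σ).getLast h ≠ 0) := by
  induction σ using List.reverseRecOn with
  | nil => simp [canonicalDFA, toIntWord]
  | append_singleton σ k ih =>
    rw [DFA.eval_append_singleton, ih]
    simp [canonicalDFA, toIntWord, or_imp, forall_and]

theorem isRegular_isCanonical (d : ℕ) :
    Language.IsRegular ({σ | IsCanonical (toIntWord σ)} : Language (SignedDigit d)) := by
  refine ⟨_, inferInstance, canonicalDFA d, ?_⟩
  ext σ
  rw [DFA.mem_accepts, eval_canonicalDFA]
  rfl

theorem canonicalRepresentations_eq_inf {d : ℕ} (hd : 2 ≤ d) (A : Set ℤ) :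
    canonicalRepresentations d A =
      representations d A ⊓ ({σ | IsCanonical (toIntWord σ)} : Language (SignedDigit d)) := by
  ext σ
  constructor
  · rintro ⟨a, ha, hσ⟩
    refine ⟨?_, ?_⟩
    · change wordValue d (toIntWord σ) ∈ A
      rwa [hσ, wordValue_canonicalWord]
    · change IsCanonical (toIntWord σ)
      rw [hσ]
      exact isCanonical_canonicalWord d a
  · rintro ⟨h₁, h₂⟩
    exact ⟨_, h₁, IsCanonical.eq_canonicalWord hd h₂ fun k => bounds_of_mem_toIntWord⟩

/-! ### Polynomial growth of languages without branching loops -/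

section Growth

variable {α Q : Type*} (M : DFA α Q)

open Classical in
/-- The last time at which the run of `M` on `w` visits the state `q` (`0` if there is none). -/
noncomputable def lastVisit (w : List α) (q : Q) : ℕ :=
  Nat.findGreatest (fun n => M.eval (w.take n) = q) w.length

theorem lastVisit_le_length (w : List α) (q : Q) : lastVisit M w q ≤ w.length := by
  classical exact Nat.findGreatest_le _

theorem le_lastVisit {w : List α} {n : ℕ} (hn : n ≤ w.length) :
    n ≤ lastVisit M w (M.eval (w.take n)) := by
  classical exact Nat.le_findGreatest hn rfl

theorem eval_take_lastVisit {w : List α} {n : ℕ} (hn : n ≤ w.length) :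
    M.eval (w.take (lastVisit M w (M.eval (w.take n)))) = M.eval (w.take n) := by
  classical
  exact Nat.findGreatest_spec (P := fun m => M.eval (w.take m) = M.eval (w.take n)) hn rfl

/-- `L` has a branching loop for `M` if two distinct words of the same length, occurring in words
of `L` after a common prefix, are loops at the state reached by that prefix. -/
def HasBranchingLoop (L : Set (List α)) : Prop :=
  ∃ u v₁ v₂ x₁ x₂ : List α, u ++ v₁ ++ x₁ ∈ L ∧ u ++ v₂ ++ x₂ ∈ L ∧ v₁ ≠ v₂ ∧
    v₁.length = v₂.length ∧ M.eval (u ++ v₁) = M.eval u ∧ M.eval (u ++ v₂) = M.eval u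

variable {M}

/-- At the first difference `t` both runs are in the same state `q`, which they last leave at the
same time `T` by the same letter. So `T ≠ t`, and the segments from `t` to `T` are two distinct
loops at `q`. -/
theorem eq_of_lastVisit_eq {L : Set (List α)} (hL : ¬ HasBranchingLoop M L) {w w' : List α}
    (hw : w ∈ L) (hw' : w' ∈ L) (hlast : ∀ q, lastVisit M w q = lastVisit M w' q)
    (hletter : ∀ q, w[lastVisit M w q]? = w'[lastVisit M w' q]?) : w = w' := by
  classical
  by_contra hne
  have hex : ∃ n : ℕ, w[n]? ≠ w'[n]? := by
    by_contra! h
    exact hne (List.ext_getElem? h)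
  set t := Nat.find hex with ht
  have hdiff : w[t]? ≠ w'[t]? := Nat.find_spec hex
  have hagree : w.take t = w'.take t := by
    refine List.ext_getElem? fun n => ?_
    rw [List.getElem?_take, List.getElem?_take]
    split_ifs with hn
    · exact not_not.1 (Nat.find_min hex hn)
    · rfl
  have hlen : t ≤ w.length ∧ t ≤ w'.length := by
    have h := congrArg List.length hagree
    rw [List.length_take, List.length_take] at h
    by_contra hcon
    refine hdiff ?_
    rw [List.getElem?_eq_none (by omega), List.getElem?_eq_none (by omega)]
  set q := M.eval (w.take t) with hq
  have hq' : M.eval (w'.take t) = q := by rw [hq, hagree]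
  set T := lastVisit M w q with hT
  have hT' : lastVisit M w' q = T := (hlast q).symm
  have htT : t ≤ T := le_lastVisit M hlen.1
  have hTw : T ≤ w.length := lastVisit_le_length M w q
  have hTw' : T ≤ w'.length := hT' ▸ lastVisit_le_length M w' q
  have hev : M.eval (w.take T) = q := eval_take_lastVisit M hlen.1
  have hev' : M.eval (w'.take T) = q := by
    have := eval_take_lastVisit M hlen.2
    rwa [hq', hT'] at this
  have hlet := hletter q
  rw [hT', ← hT] at hlet
  have hsplit : ∀ v : List α, v.take t ++ (v.take T).drop t = v.take T := fun v => by
    conv_rhs => rw [← List.take_append_drop t (v.take T), List.take_take, min_eq_left htT]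
  refine hL ⟨w.take t, (w.take T).drop t, (w'.take T).drop t, w.drop T, w'.drop T,
    ?_, ?_, ?_, ?_, ?_, ?_⟩
  · rwa [hsplit, List.take_append_drop]
  · rwa [hagree, hsplit, List.take_append_drop]
  · intro heq
    have htake : w.take T = w'.take T := by rw [← hsplit w, ← hsplit w', hagree, heq]
    rcases htT.eq_or_lt with h | h
    · exact hdiff (h ▸ hlet)
    · have := congrArg (fun l : List α => l[t]?) htake
      simp only [List.getElem?_take, if_pos h] at this
      exact hdiff this
  · simp only [List.length_drop, List.length_take]
    omega
  · rw [hsplit, hev]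
  · rw [hagree, hsplit, hev', hq']

theorem exists_ncard_le_of_not_hasBranchingLoop [Finite α] [Finite Q] {L : Set (List α)}
    (hL : ¬ HasBranchingLoop M L) :
    ∃ C m : ℕ, ∀ k : ℕ, {σ : List α | σ ∈ L ∧ σ.length ≤ k}.ncard ≤ C * (k + 1) ^ m := by
  refine ⟨(Nat.card (Option α)) ^ Nat.card Q, Nat.card Q, fun k => ?_⟩
  -- The letter is `none` when the last visit is at the end of the word, hence `Option α`.
  let F : {σ : List α | σ ∈ L ∧ σ.length ≤ k} → Q → Option α × Fin (k + 1) := fun σ q =>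
    (σ.1[lastVisit M σ.1 q]?,
      ⟨lastVisit M σ.1 q, Nat.lt_succ_of_le ((lastVisit_le_length M σ.1 q).trans σ.2.2)⟩)
  have hF : Function.Injective F := by
    intro σ τ h
    refine Subtype.ext (eq_of_lastVisit_eq hL σ.2.1 τ.2.1 (fun q => ?_) fun q => ?_)
    · exact congrArg (fun x => (x.2 : ℕ)) (congrFun h q)
    · exact congrArg Prod.fst (congrFun h q)
  have := Nat.card_le_card_of_injective F hF
  rwa [Nat.card_fun, Nat.card_prod, Nat.card_fin, mul_pow] at this

end Growth

/-! ### Stable automatic sets -/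

theorem exists_hasBranchingLoop_of_not_isSparse {d : ℕ} (hd : 2 ≤ d) {A : Set ℤ}
    (hA : IsAutomatic d A) (hs : ¬ IsSparse d A) :
    ∃ (Q : Type) (M : DFA (SignedDigit d) Q), M.accepts = representations d A ∧
      HasBranchingLoop M (canonicalRepresentations d A) := by
  have hreg : (canonicalRepresentations d A).IsRegular :=
    canonicalRepresentations_eq_inf hd A ▸ hA.inf (isRegular_isCanonical d)
  obtain ⟨Q, _, M, hM⟩ := hA
  refine ⟨Q, M, hM, ?_⟩
  by_contra hL
  exact hs ⟨hreg, exists_ncard_le_of_not_hasBranchingLoop hL⟩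

theorem isGeneric_of_hasBranchingLoop {d : ℕ} (hd : 2 ≤ d) {A : Set ℤ} (hst : IsStableIn A)
    {Q : Type*} {M : DFA (SignedDigit d) Q} (hM : M.accepts = representations d A)
    (hL : HasBranchingLoop M (canonicalRepresentations d A)) : IsGeneric A := by
  obtain ⟨u, v₁, v₂, x₁, x₂, hx₁, hx₂, hne, hlen, he₁, he₂⟩ := hL
  have hmem : ∀ σ, wordValue d (toIntWord σ) ∈ A ↔ M.eval σ ∈ M.accept := fun σ => by
    rw [← DFA.mem_accepts, hM]
    rfl
  have happ : ∀ σ τ : List (SignedDigit d), wordValue d (toIntWord (σ ++ τ)) =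
      wordValue d (toIntWord σ) + (d : ℤ) ^ σ.length * wordValue d (toIntWord τ) := fun σ τ => by
    rw [toIntWord_append, wordValue_append, length_toIntWord]
  set B : Set ℤ := {x | wordValue d (toIntWord u) + (d : ℤ) ^ u.length * x ∈ A} with hB
  have hloop : ∀ v, M.eval (u ++ v) = M.eval u → ∀ x,
      wordValue d (toIntWord v) + (d : ℤ) ^ v.length * x ∈ B ↔ x ∈ B := by
    intro v hv x
    -- Any word for `x` serves: `M` reads all signed representations, so `u ++ v ++ σ` need not be
    -- canonical.
    obtain ⟨σ, hσ⟩ := exists_toIntWord_eq_canonicalWord hd x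
    obtain rfl : wordValue d (toIntWord σ) = x := by rw [hσ, wordValue_canonicalWord]
    rw [hB, Set.mem_ofPred_eq, Set.mem_ofPred_eq, ← happ, ← happ, ← happ, hmem, hmem,
      ← List.append_assoc]
    simp only [DFA.eval] at hv ⊢
    rw [DFA.evalFrom_of_append, hv, DFA.evalFrom_of_append]
  -- Canonicity matters only here: it forces distinct loops to have distinct values.
  have hcan : ∀ v x, u ++ v ++ x ∈ canonicalRepresentations d A →
      HasConstantSign (toIntWord v) := by
    rintro v x ⟨a, -, h⟩
    have h₁ := (isCanonical_canonicalWord d a).1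
    rw [← h, toIntWord_append, toIntWord_append] at h₁
    exact h₁.of_sublist ((List.sublist_append_right _ _).trans (List.sublist_append_left _ _))
  have hval : wordValue d (toIntWord v₁) ≠ wordValue d (toIntWord v₂) := fun h =>
    hne <| toIntWord_injective <| eq_of_wordValue_eq (hcan v₁ x₁ hx₁) (hcan v₂ x₂ hx₂)
      (fun _ => bounds_of_mem_toIntWord) (fun _ => bounds_of_mem_toIntWord)
      (by rw [length_toIntWord, length_toIntWord, hlen]) h
  have hBne : B.Nonempty := by
    rw [canonicalRepresentations_eq_inf hd] at hx₁
    have : wordValue d (toIntWord (u ++ v₁ ++ x₁)) ∈ A := hx₁.1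
    rw [List.append_assoc, happ] at this
    exact ⟨_, this⟩
  obtain ⟨K, hK⟩ := exists_mem_near_of_stable (hst.preimage_affine _ _)
    (one_le_pow₀ (by omega) : (1 : ℤ) ≤ (d : ℤ) ^ v₁.length) (hloop v₁ he₁)
    (by rw [hlen]; exact hloop v₂ he₂) hval hBne
  exact isGeneric_of_preimage (pow_pos (by omega) _) hK

theorem isGeneric_of_not_isSparse {d : ℕ} (hd : 2 ≤ d) {A : Set ℤ} (hA : IsAutomatic d A)
    (hs : ¬ IsSparse d A) (hst : IsStableIn A) : IsGeneric A := by
  obtain ⟨Q, M, hM, hL⟩ := exists_hasBranchingLoop_of_not_isSparse hd hA hs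
  exact isGeneric_of_hasBranchingLoop hd hst hM hL

end AutomaticSets

theorem mainTheorem5 (d : ℕ) (hd : 2 ≤ d) :
    (∀ A : Set ℤ, AutomaticSets.IsAutomatic d A → ¬ AutomaticSets.IsSparse d A →
      AutomaticSets.IsStableIn A → AutomaticSets.IsGeneric A) ∧
    (∀ A : Set ℤ, A ⊆ Set.range ((↑) : ℕ → ℤ) → AutomaticSets.IsAutomatic d A →
      AutomaticSets.IsStableIn A → AutomaticSets.IsSparse d A) := by
  refine ⟨fun A hA hs hst => AutomaticSets.isGeneric_of_not_isSparse hd hA hs hst,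
    fun A hN hA hst => ?_⟩
  by_contra hs
  exact AutomaticSets.not_isGeneric_of_subset_range_natCast hN
    (AutomaticSets.isGeneric_of_not_isSparse hd hA hs hst)
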